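/- Let $d\ge 1$ and $1<p<\infty$, and put $p'=p/(p-1)$. A cube is a non-degenerate cube in $\mathbb{R}^d$ with sides parallel to the axes. For $0\le\alpha<d$ and a locally integrable $\varphi:\mathbb{R}^d\to\mathbb{R}$ let $$\mathcal{M}^\alpha\varphi(x)=\sup\Big\{|Q|^{\frac{\alpha}{d}-1}\int_Q|\varphi(u)|\,du:\ Q\text{ is a cube containing }x\Big\}.$$ A weight is a locally integrable, (a.e.) positive function $w$ on $\mathbb{R}^d$. For $1<r<\infty$, $w$ is an $A_r$ weight if $$[w]_{A_r}=\sup_Q\Big(\frac1{|Q|}\int_Q w\Big)\Big(\frac1{|Q|}\int_Q w^{-1/(r-1)}\Big)^{r-1}<\infty,$$ where the supremum is over all cubes $Q$. Write $\|f\|_{L^p(v)}=\big(\int_{\mathbb{R}^d}|f|^p v\,du\big)^{1/p}\in[0,\infty]$. (i) Let $0\le\alpha<d$ and let $0<q<\infty$ satisfy $\frac1q=\frac1p-\frac{\alpha}{d}$. There is a finite constant $C_{p,\alpha,d}$, depending only on $p$, $\alpha$ and $d$, such that for every $A_{q/p'+1}$ weight $w$ and every locally integrable $\varphi$ on $\mathbb{R}^d$,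 $$\|\mathcal{M}^\alpha\varphi\|_{L^q(w)}\le C_{p,\alpha,d}\,[w]_{A_{q/p'+1}}^{(1-\alpha/d)p'/q}\,\|\varphi\|_{L^p(w^{p/q})}.$$ (ii) In particular (the case $\alpha=0$, $q=p$), there is a finite constant $C_{p,d}$, depending only on $p$ and $d$, such that for every $A_p$ weight $w$ and every locally integrable $\varphi$ on $\mathbb{R}^d$, $$\|\mathcal{M}^0\varphi\|_{L^p(w)}\le C_{p,d}\,[w]_{A_p}^{1/(p-1)}\,\|\varphi\|_{L^p(w)}.$$ -/

import Mathlib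

open MeasureTheory Set
open scoped ENNReal NNReal

noncomputable section

/-- `Q` is a (closed, non-degenerate) cube in `ℝ^d` with sides parallel to the axes: the product of
the intervals `[a i, a i + l]` with one common side length `l > 0`. -/
def IsCube {d : ℕ} (Q : Set (Fin d → ℝ)) : Prop :=
  ∃ (a : Fin d → ℝ) (l : ℝ), 0 < l ∧ Q = Icc a (fun i => a i + l)

/-- The fractional maximal operator of order `α`, as a function with values in `[0, ∞]`:
the supremum of `|Q|^(α/d - 1) ∫_Q |φ|` over all cubes `Q` containing `x`. -/
def fracMaximal {d : ℕ} (α : ℝ) (φ : (Fin d → ℝ) → ℝ) (x : Fin d → ℝ) : ℝ≥0∞ :=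
  ⨆ (Q : Set (Fin d → ℝ)) (_ : IsCube Q) (_ : x ∈ Q),
    volume Q ^ (α / d - 1) * ∫⁻ u in Q, ‖φ u‖ₑ

/-- A weight: a locally integrable, (almost everywhere) positive function on `ℝ^d`. -/
def IsWeight {d : ℕ} (w : (Fin d → ℝ) → ℝ) : Prop :=
  LocallyIntegrable w volume ∧ ∀ᵐ x, 0 < w x

/-- The `A_r` characteristic `[w]_{A_r}` (for `1 < r < ∞`), with values in `[0, ∞]`: the supremum
over all cubes `Q` of the average of `w` over `Q` times the `(r - 1)`-th power of the average of
`w^(-1/(r-1))` over `Q`. -/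
def ApChar {d : ℕ} (r : ℝ) (w : (Fin d → ℝ) → ℝ) : ℝ≥0∞ :=
  ⨆ (Q : Set (Fin d → ℝ)) (_ : IsCube Q),
    ((volume Q)⁻¹ * ∫⁻ x in Q, ENNReal.ofReal (w x)) *
      ((volume Q)⁻¹ * ∫⁻ x in Q, ENNReal.ofReal (w x) ^ (-1 / (r - 1))) ^ (r - 1)

/-- `w` is an `A_r` weight. -/
def IsApWeight {d : ℕ} (r : ℝ) (w : (Fin d → ℝ) → ℝ) : Prop :=
  IsWeight w ∧ ApChar r w < ∞

/-- The norm `(∫ f^p v)^(1/p)` in the weighted space `L^p(v)` of a function `f` with values in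
`[0, ∞]`. The value is `∞` if the integral diverges. -/
def weightedNorm {d : ℕ} (p : ℝ) (v : (Fin d → ℝ) → ℝ) (f : (Fin d → ℝ) → ℝ≥0∞) : ℝ≥0∞ :=
  (∫⁻ x, f x ^ p * ENNReal.ofReal (v x)) ^ (1 / p)

end

/-! Every cube lies in a cube of comparable volume from one of `2 ^ d` shifted triadic grids, so the
problem reduces to the maximal operator of a nested family. Nested families need no covering lemma.
Their maximal operators are therefore bounded on `L^p(μ)` for arbitrary s-finite `μ`, with a
constant independent of `μ` (`NestedFamily.strong_type`), and interpolating with Hölder gives the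
fractional `L^p(μ) → L^q(μ)` bound (`NestedFamily.fractional_strong_type`).

The weighted bound (`NestedFamily.weighted_strong_type`) applies both, with two different measures.
Put `r = q/p' + 1`, `r' = r/(r-1)` and `S = W^(-1/(r-1))`. On each member the `A_r` condition bounds
the `q`-th power of the fractional average by `K^r'` times the `r'`-th power of a `W`-average of
`G^(q/r') / W`, where `G` is the fractional maximal function of `f / S` for the measure `S dν`. The
`L^r'(W)` bound followed by the `L^p(S) → L^q(S)` bound finishes the estimate. The weight constant
enters once, as `K^r'`; after the `q`-th root its exponent is `r'/q = (1 - α/d) p'/q`. -/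

/-! ### Nested families and the weak type inequality -/

/-- Any two members of the family are either nested or disjoint. -/
def NestedFamily {X ι : Type*} (P : ι → Set X) : Prop :=
  ∀ i j, P i ⊆ P j ∨ P j ⊆ P i ∨ Disjoint (P i) (P j)

/-- The function `x ↦ sup {c i : x ∈ P i}`. -/
noncomputable def familySup {X ι : Type*} (P : ι → Set X) (c : ι → ℝ≥0∞) (x : X) : ℝ≥0∞ :=
  ⨆ i, (P i).indicator (fun _ => c i) x

section NestedMaximal

variable {X ι : Type*} {P : ι → Set X}

theorem le_familySup (c : ι → ℝ≥0∞) {i : ι} {x : X} (hx : x ∈ P i) : c i ≤ familySup P c x := by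
  refine le_trans ?_ (le_iSup _ i)
  rw [indicator_of_mem hx]

theorem familySup_le {c : ι → ℝ≥0∞} {x : X} {b : ℝ≥0∞} (h : ∀ i, x ∈ P i → c i ≤ b) :
    familySup P c x ≤ b := by
  refine iSup_le fun i => ?_
  by_cases hx : x ∈ P i
  · rw [indicator_of_mem hx]; exact h i hx
  · rw [indicator_of_notMem hx]; exact zero_le

theorem measurable_familySup [MeasurableSpace X] [Countable ι]
    (hP : ∀ i, MeasurableSet (P i)) (c : ι → ℝ≥0∞) :
    Measurable (familySup P c) :=
  Measurable.iSup fun i => measurable_const.indicator (hP i)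

/-- Members contained in a maximal one add nothing to the union, and by nestedness all others are
disjoint from it. The hypotheses `ht` thus add up over disjoint sets, with no covering constant. -/
theorem NestedFamily.mul_measure_biUnion_finset_le [MeasurableSpace X]
    (hn : NestedFamily P)
    (hP : ∀ i, MeasurableSet (P i)) (μ : Measure X) (f : X → ℝ≥0∞) (t : ℝ≥0∞)
    (ht : ∀ i, t * μ (P i) ≤ ∫⁻ x in P i, f x ∂μ) (s : Finset ι) :
    t * μ (⋃ i ∈ s, P i) ≤ ∫⁻ x in ⋃ i ∈ s, P i, f x ∂μ := by
  classical
  induction s using Finset.strongInduction with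
  | H s ih =>
    rcases s.eq_empty_or_nonempty with rfl | hs
    · simp
    obtain ⟨i, hi⟩ := s.exists_maximalFor P hs
    have his : i ∈ s := hi.1
    set s' := (s.erase i).filter (fun j => Disjoint (P i) (P j)) with hs'
    have hss : s' ⊂ s := (Finset.filter_subset _ _).trans_ssubset (Finset.erase_ssubset his)
    have hU : (⋃ j ∈ s, P j) = P i ∪ ⋃ j ∈ s', P j := by
      apply subset_antisymm
      · refine iUnion₂_subset fun j hj => ?_
        by_cases hji : j = i
        · subst hji; exact subset_union_left
        rcases hn i j with h | h | h
        · exact (hi.2 hj h).trans subset_union_left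
        · exact h.trans subset_union_left
        · refine subset_union_of_subset_right ?_ _
          exact subset_biUnion_of_mem (u := fun j => P j)
            (Finset.mem_filter.2 ⟨Finset.mem_erase.2 ⟨hji, hj⟩, h⟩)
      · refine union_subset (subset_biUnion_of_mem (u := fun j => P j) his) ?_
        exact biUnion_subset_biUnion_left hss.1
    have hd : Disjoint (P i) (⋃ j ∈ s', P j) := by
      refine disjoint_iUnion₂_right.2 fun j hj => (Finset.mem_filter.1 hj).2
    rw [hU, lintegral_union (s'.measurableSet_biUnion fun j _ => hP j) hd]
    calc t * μ (P i ∪ ⋃ j ∈ s', P j) ≤ t * (μ (P i) + μ (⋃ j ∈ s', P j)) := by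
          gcongr; exact measure_union_le _ _
      _ ≤ _ := by rw [mul_add]; exact add_le_add (ht i) (ih s' hss)

theorem NestedFamily.mul_measure_iUnion_le [MeasurableSpace X] [Countable ι]
    (hn : NestedFamily P)
    (hP : ∀ i, MeasurableSet (P i)) (μ : Measure X) (f : X → ℝ≥0∞) (t : ℝ≥0∞)
    (ht : ∀ i, t * μ (P i) ≤ ∫⁻ x in P i, f x ∂μ) :
    t * μ (⋃ i, P i) ≤ ∫⁻ x, f x ∂μ := by
  have hd : Directed (· ⊆ ·) fun s : Finset ι => ⋃ i ∈ s, P i :=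
    directed_of_isDirected_le fun _ _ h => biUnion_subset_biUnion_left h
  rw [iUnion_eq_iUnion_finset, hd.measure_iUnion, ENNReal.mul_iSup]
  refine iSup_le fun s => ?_
  exact (hn.mul_measure_biUnion_finset_le hP μ f t ht s).trans (setLIntegral_le_lintegral _ _)

/-- The averages of `f` over the members of a family of sets. -/
noncomputable def setMean [MeasurableSpace X] (P : ι → Set X) (μ : Measure X) (f : X → ℝ≥0∞) (i : ι) : ℝ≥0∞ :=
  (μ (P i))⁻¹ * ∫⁻ x in P i, f x ∂μ

/-- Weak type `(1,1)` inequality for the maximal operator of a nested family. -/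
theorem NestedFamily.weak_type [MeasurableSpace X] [Countable ι]
    (hn : NestedFamily P)
    (hP : ∀ i, MeasurableSet (P i)) (μ : Measure X) (f : X → ℝ≥0∞) (t : ℝ≥0∞) :
    t * μ {x | t < familySup P (setMean P μ f) x} ≤ ∫⁻ x, f x ∂μ := by
  -- The members with average above `t` cover the level set and form a nested family themselves.
  set J := {i // t < setMean P μ f i}
  have hnJ : NestedFamily fun j : J => P j := fun i j => hn i j
  refine le_trans ?_ (hnJ.mul_measure_iUnion_le (fun j => hP j) μ f t fun j => ?_)
  · gcongr
    intro x hx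
    obtain ⟨i, hi⟩ := lt_iSup_iff.1 (show t < ⨆ i, _ from hx)
    by_cases hxi : x ∈ P i
    · rw [indicator_of_mem hxi] at hi
      exact mem_iUnion.2 ⟨⟨i, hi⟩, hxi⟩
    · rw [indicator_of_notMem hxi] at hi
      exact absurd hi (not_lt_bot)
  · have h := j.2.le
    rw [setMean] at h
    calc t * μ (P j) ≤ (μ (P j))⁻¹ * (∫⁻ x in P j, f x ∂μ) * μ (P j) := by gcongr
      _ = (μ (P j))⁻¹ * μ (P j) * (∫⁻ x in P j, f x ∂μ) := by ring
      _ ≤ 1 * (∫⁻ x in P j, f x ∂μ) := by gcongr; exact ENNReal.inv_mul_le_one _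
      _ = _ := one_mul _

/-- A constant has average at most itself, also on members of measure `0` or `∞`, where the average
is `0` by convention. -/
theorem setMean_le_add [MeasurableSpace X]
    (μ : Measure X) {f g : X → ℝ≥0∞} {b : ℝ≥0∞}
    (h : ∀ x, f x ≤ g x + b) (i : ι) : setMean P μ f i ≤ setMean P μ g i + b := by
  calc setMean P μ f i ≤ (μ (P i))⁻¹ * ∫⁻ x in P i, (g x + b) ∂μ := by
        unfold setMean; gcongr; exact h _
    _ = setMean P μ g i + (μ (P i))⁻¹ * μ (P i) * b := by
        rw [lintegral_add_right _ measurable_const, lintegral_const, Measure.restrict_apply_univ,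
          mul_add]; unfold setMean; ring
    _ ≤ setMean P μ g i + 1 * b := by gcongr; exact ENNReal.inv_mul_le_one _
    _ = _ := by rw [one_mul]

/-- Weak type inequality with the truncation of `f` at half the height. -/
theorem NestedFamily.measure_lt_familySup_le [MeasurableSpace X] [Countable ι]
    (hn : NestedFamily P)
    (hP : ∀ i, MeasurableSet (P i)) (μ : Measure X) {f : X → ℝ≥0∞} {t : ℝ≥0∞}
    (ht : t ≠ 0) (ht' : t ≠ ∞) :
    μ {x | t < familySup P (setMean P μ f) x} ≤
      2 / t * ∫⁻ x, {x | t < 2 * f x}.indicator f x ∂μ := by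
  -- The discarded part of `f` is at most `t / 2`, so an average of `f` above `t` forces one of `g`
  -- above `t / 2`.
  set g := {x | t < 2 * f x}.indicator f
  have h2 : t / 2 ≠ 0 := by simp [ht]
  have h2' : t / 2 ≠ ∞ := ENNReal.div_ne_top ht' (by simp)
  have hfg : ∀ x, f x ≤ g x + t / 2 := by
    intro x
    by_cases hx : t < 2 * f x
    · simp only [g]; rw [indicator_of_mem (by exact hx)]; exact le_self_add
    · refine le_trans ?_ le_add_self
      rw [ENNReal.le_div_iff_mul_le (by simp) (by simp), mul_comm]
      exact not_lt.1 hx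
  have hsub : {x | t < familySup P (setMean P μ f) x} ⊆
      {x | t / 2 < familySup P (setMean P μ g) x} := by
    intro x hx
    have : familySup P (setMean P μ f) x ≤ familySup P (setMean P μ g) x + t / 2 :=
      familySup_le fun i hi => (setMean_le_add μ hfg i).trans (by
        gcongr; exact le_familySup _ hi)
    have h3 := lt_of_lt_of_le hx this
    by_contra hc
    have hc : familySup P (setMean P μ g) x ≤ t / 2 := not_lt.1 hc
    have : t < t := h3.trans_le (by
      calc _ ≤ t / 2 + t / 2 := by gcongr
        _ = t := ENNReal.add_halves t)
    exact lt_irrefl _ this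
  have hw := hn.weak_type hP μ g (t / 2)
  calc _ ≤ μ {x | t / 2 < familySup P (setMean P μ g) x} := measure_mono hsub
    _ = 2 / t * (t / 2 * μ {x | t / 2 < familySup P (setMean P μ g) x}) := by
        rw [← mul_assoc, ← ENNReal.inv_div (a := t) (b := 2) (by simp) (by simp),
          ENNReal.inv_mul_cancel h2 h2', one_mul]
    _ ≤ _ := by gcongr

end NestedMaximal

/-! ### Layer cake formula and strong type bounds for an arbitrary measure -/

theorem ENNReal.rpow_eq_lintegral_of_ne_top {p : ℝ} (hp : 0 < p) {a : ℝ≥0∞} (ha : a ≠ ∞) :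
    a ^ p = ∫⁻ t in Ioi (0 : ℝ), {t : ℝ | ENNReal.ofReal t < a}.indicator
      (fun t => ENNReal.ofReal (p * t ^ (p - 1))) t := by
  lift a to ℝ≥0 using ha
  have hset : {t : ℝ | ENNReal.ofReal t < a} ∩ Ioi 0 = Ioo (0 : ℝ) a := by
    ext t
    simp only [mem_inter_iff, mem_ofPred_eq, mem_Ioi, mem_Ioo]
    refine ⟨fun h => ⟨h.2, ?_⟩, fun h => ⟨?_, h.1⟩⟩
    · have := (ENNReal.ofReal_lt_iff_lt_toReal h.2.le (by simp)).1 h.1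
      simpa using this
    · exact (ENNReal.ofReal_lt_iff_lt_toReal h.1.le (by simp)).2 (by simpa using h.2)
  have hm : MeasurableSet {t : ℝ | ENNReal.ofReal t < a} :=
    measurableSet_lt ENNReal.measurable_ofReal measurable_const
  rw [lintegral_indicator hm, Measure.restrict_restrict hm, hset,
    Measure.restrict_congr_set Ioo_ae_eq_Ioc, ← ofReal_integral_eq_lintegral_ofReal]
  · rw [← intervalIntegral.integral_of_le a.coe_nonneg, intervalIntegral.integral_const_mul,
      integral_rpow (Or.inl (by linarith)), sub_add_cancel, Real.zero_rpow hp.ne', sub_zero,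
      mul_div_cancel₀ _ hp.ne', ← ENNReal.ofReal_rpow_of_nonneg a.coe_nonneg hp.le,
      ENNReal.ofReal_coe_nnreal]
  · refine Integrable.const_mul ?_ _
    exact (intervalIntegral.intervalIntegrable_rpow' (by linarith)).1
  · filter_upwards [ae_restrict_mem measurableSet_Ioc] with t ht
    exact mul_nonneg hp.le (Real.rpow_nonneg ht.1.le _)

/-- The layer cake formula for a power of a single extended nonnegative real. -/
theorem ENNReal.rpow_eq_lintegral {p : ℝ} (hp : 0 < p) (a : ℝ≥0∞) :
    a ^ p = ∫⁻ t in Ioi (0 : ℝ), {t : ℝ | ENNReal.ofReal t < a}.indicator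
      (fun t => ENNReal.ofReal (p * t ^ (p - 1))) t := by
  by_cases ha : a = ∞
  swap
  · exact ENNReal.rpow_eq_lintegral_of_ne_top hp ha
  subst ha
  rw [ENNReal.top_rpow_of_pos hp, eq_comm]
  -- By the finite case each `r` is the integral belonging to `r^(1/p)`, and the integrand grows
  -- with the height.
  refine ENNReal.eq_top_of_forall_nnreal_le fun r => ?_
  have h := ENNReal.rpow_eq_lintegral_of_ne_top hp (a := (r : ℝ≥0∞) ^ p⁻¹)
    (ENNReal.rpow_ne_top_of_nonneg (by positivity) (by simp))
  rw [← ENNReal.rpow_mul, inv_mul_cancel₀ hp.ne', ENNReal.rpow_one] at h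
  rw [h]
  refine lintegral_mono fun t => ?_
  refine indicator_le_indicator_of_subset (fun t ht => ?_) (fun _ => zero_le) _
  exact ENNReal.ofReal_lt_top

theorem lintegral_rpow_eq_lintegral_measure_lt {X : Type*} [MeasurableSpace X] (μ : Measure X)
    [SFinite μ] {p : ℝ} (hp : 0 < p) {f : X → ℝ≥0∞} (hf : Measurable f) :
    ∫⁻ x, f x ^ p ∂μ = ∫⁻ t in Ioi (0 : ℝ),
      ENNReal.ofReal (p * t ^ (p - 1)) * μ {x | ENNReal.ofReal t < f x} := by
  simp_rw [ENNReal.rpow_eq_lintegral hp (f _)]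
  have hm : MeasurableSet {z : X × ℝ | ENNReal.ofReal z.2 < f z.1} :=
    measurableSet_lt (ENNReal.measurable_ofReal.comp measurable_snd) (hf.comp measurable_fst)
  rw [lintegral_lintegral_swap]
  · refine lintegral_congr fun t => ?_
    rw [← lintegral_indicator_const (measurableSet_lt measurable_const hf)]
    rfl
  · have : Measurable fun z : X × ℝ => {z : X × ℝ | ENNReal.ofReal z.2 < f z.1}.indicator
        (fun z => ENNReal.ofReal (p * z.2 ^ (p - 1))) z :=
      Measurable.indicator (by fun_prop) hm
    exact this.aemeasurable

theorem NestedFamily.strong_type_of_measurable {X ι : Type*} [MeasurableSpace X] [Countable ι]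
    {P : ι → Set X} (hn : NestedFamily P)
    (hP : ∀ i, MeasurableSet (P i)) (μ : Measure X) [SFinite μ] {p : ℝ} (hp : 1 < p)
    {f : X → ℝ≥0∞} (hf : Measurable f) :
    ∫⁻ x, familySup P (setMean P μ f) x ^ p ∂μ ≤
      ENNReal.ofReal (2 ^ p * p / (p - 1)) * ∫⁻ x, f x ^ p ∂μ := by
  have hp0 : 0 < p := by linarith
  have hp1 : 0 < p - 1 := by linarith
  have hm : MeasurableSet {z : X × ℝ | ENNReal.ofReal z.2 < 2 * f z.1} :=
    measurableSet_lt (ENNReal.measurable_ofReal.comp measurable_snd)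
      ((hf.const_mul 2).comp measurable_fst)
  -- Chosen so that `p t^(p-1) * (2/t) = c (p-1) t^(p-2)`, the layer cake density for the exponent
  -- `p - 1`.
  set c := ENNReal.ofReal (2 * p / (p - 1)) with hc
  rw [lintegral_rpow_eq_lintegral_measure_lt μ hp0 (measurable_familySup hP _)]
  calc _ ≤ ∫⁻ t in Ioi (0 : ℝ), ∫⁻ x, {z : X × ℝ | ENNReal.ofReal z.2 < 2 * f z.1}.indicator
        (fun z => c * f z.1 * ENNReal.ofReal ((p - 1) * z.2 ^ (p - 1 - 1))) (x, t) ∂μ := by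
        refine setLIntegral_mono' measurableSet_Ioi fun t ht => ?_
        have ht : 0 < t := ht
        have h := hn.measure_lt_familySup_le hP μ (f := f) (t := ENNReal.ofReal t)
          (by simpa using ht) (by simp)
        have hms : MeasurableSet {x | ENNReal.ofReal t < 2 * f x} :=
          measurableSet_lt measurable_const (hf.const_mul 2)
        have h2 : ENNReal.ofReal (p * t ^ (p - 1)) * (2 / ENNReal.ofReal t) =
            c * ENNReal.ofReal ((p - 1) * t ^ (p - 1 - 1)) := by
          have : (2 : ℝ≥0∞) = ENNReal.ofReal 2 := by simp
          rw [this, ← ENNReal.ofReal_div_of_pos ht, ← ENNReal.ofReal_mul (by positivity), hc,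
            ← ENNReal.ofReal_mul (by positivity), Real.rpow_sub_one ht.ne' (p - 1)]
          congr 1
          field_simp
        calc _ ≤ ENNReal.ofReal (p * t ^ (p - 1)) * (2 / ENNReal.ofReal t *
              ∫⁻ x, {x | ENNReal.ofReal t < 2 * f x}.indicator f x ∂μ) := by gcongr
          _ = ∫⁻ x, c * ENNReal.ofReal ((p - 1) * t ^ (p - 1 - 1)) *
                {x | ENNReal.ofReal t < 2 * f x}.indicator f x ∂μ := by
              rw [← mul_assoc, h2, lintegral_const_mul _ (hf.indicator hms)]
          _ ≤ _ := by
              refine lintegral_mono fun x => ?_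
              by_cases hx : ENNReal.ofReal t < 2 * f x
              · rw [indicator_of_mem (by exact hx), indicator_of_mem (by exact hx)]
                exact le_of_eq (by ring)
              · rw [indicator_of_notMem (by exact hx)]; simp
    _ = ∫⁻ x, (∫⁻ t in Ioi (0 : ℝ), {z : X × ℝ | ENNReal.ofReal z.2 < 2 * f z.1}.indicator
        (fun z => c * f z.1 * ENNReal.ofReal ((p - 1) * z.2 ^ (p - 1 - 1))) (x, t)) ∂μ := by
        refine (lintegral_lintegral_swap ?_).symm
        refine Measurable.aemeasurable ?_
        exact Measurable.indicator (by fun_prop) hm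
    _ = ∫⁻ x, c * f x * (2 * f x) ^ (p - 1) ∂μ := by
        refine lintegral_congr fun x => ?_
        rw [ENNReal.rpow_eq_lintegral hp1 (2 * f x), ← lintegral_const_mul]
        · refine lintegral_congr fun t => ?_
          by_cases hx : ENNReal.ofReal t < 2 * f x
          · rw [indicator_of_mem (by exact hx), indicator_of_mem (by exact hx)]
          · rw [indicator_of_notMem (by exact hx), indicator_of_notMem (by exact hx), mul_zero]
        · exact Measurable.indicator (by fun_prop)
            (measurableSet_lt ENNReal.measurable_ofReal measurable_const)
    _ = _ := by
        rw [← lintegral_const_mul _ (hf.pow_const p)]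
        refine lintegral_congr fun x => ?_
        rw [ENNReal.mul_rpow_of_nonneg _ _ hp1.le]
        have h1 : f x * f x ^ (p - 1) = f x ^ p := by
          nth_rewrite 1 [← ENNReal.rpow_one (f x)]
          rw [← ENNReal.rpow_add_of_nonneg _ _ zero_le_one hp1.le]
          congr 1; ring
        have h2 : c * 2 ^ (p - 1) = ENNReal.ofReal (2 ^ p * p / (p - 1)) := by
          have : (2 : ℝ≥0∞) = ENNReal.ofReal 2 := by simp
          rw [this, ENNReal.ofReal_rpow_of_pos two_pos, hc, ← ENNReal.ofReal_mul (by positivity),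
            Real.rpow_sub_one two_ne_zero]
          congr 1
          field_simp
        rw [← h1, ← h2]; ring

/-- Strong type `(p,p)` inequality for the maximal operator of a nested family, with a constant
that does not depend on the measure. -/
theorem NestedFamily.strong_type {X ι : Type*} [MeasurableSpace X] [Countable ι]
    {P : ι → Set X} (hn : NestedFamily P)
    (hP : ∀ i, MeasurableSet (P i)) (μ : Measure X) [SFinite μ] {p : ℝ} (hp : 1 < p)
    {f : X → ℝ≥0∞} (hf : AEMeasurable f μ) :
    ∫⁻ x, familySup P (setMean P μ f) x ^ p ∂μ ≤
      ENNReal.ofReal (2 ^ p * p / (p - 1)) * ∫⁻ x, f x ^ p ∂μ := by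
  have h := hn.strong_type_of_measurable hP μ hp hf.measurable_mk
  have h1 : setMean P μ (hf.mk f) = setMean P μ f := by
    funext i
    rw [setMean, setMean, lintegral_congr_ae (ae_restrict_of_ae hf.ae_eq_mk.symm)]
  have h2 : ∫⁻ x, hf.mk f x ^ p ∂μ = ∫⁻ x, f x ^ p ∂μ :=
    lintegral_congr_ae (hf.ae_eq_mk.symm.mono fun x hx => by simp only [hx])
  rwa [h1, h2] at h

theorem setLIntegral_le_rpow_mul_measure_rpow {X : Type*} [MeasurableSpace X] (μ : Measure X)
    {p : ℝ} (hp : 1 < p) {g : X → ℝ≥0∞} (hg : AEMeasurable g μ) (A : Set X) :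
    ∫⁻ x in A, g x ∂μ ≤ (∫⁻ x, g x ^ p ∂μ) ^ (1 / p) * μ A ^ (1 - 1 / p) := by
  have hpq := Real.HolderConjugate.conjExponent hp
  have h := ENNReal.lintegral_mul_le_Lp_mul_Lq (μ.restrict A) hpq hg.restrict
    (aemeasurable_const (b := 1))
  simp only [Pi.mul_apply, mul_one, ENNReal.one_rpow, lintegral_const,
    Measure.restrict_apply_univ, one_mul] at h
  refine h.trans ?_
  have h1 : 1 / p.conjExponent = 1 - 1 / p := by
    have := hpq.inv_add_inv_eq_one
    rw [one_div, one_div]; linarith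
  rw [h1]
  gcongr
  exact Measure.restrict_le_self

/-- Boundedness `L^p(μ) → L^q(μ)` of the fractional maximal operator of a nested family, with a
constant that does not depend on the measure. -/
theorem NestedFamily.fractional_strong_type {X ι : Type*} [MeasurableSpace X] [Countable ι]
    {P : ι → Set X} (hn : NestedFamily P)
    (hP : ∀ i, MeasurableSet (P i)) (μ : Measure X) [SFinite μ] {p q : ℝ} (hp : 1 < p)
    (hpq : p ≤ q) (hμ : ∀ i, μ (P i) ≠ 0) (hμ' : ∀ i, μ (P i) ≠ ∞)
    {g : X → ℝ≥0∞} (hg : AEMeasurable g μ) :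
    ∫⁻ x, familySup P
        (fun i => μ (P i) ^ (-(1 / q + 1 - 1 / p)) * ∫⁻ y in P i, g y ∂μ) x ^ q ∂μ ≤
      ENNReal.ofReal (2 ^ p * p / (p - 1)) * (∫⁻ x, g x ^ p ∂μ) ^ (q / p) := by
  have hp0 : 0 < p := by linarith
  have hp1 : 0 < p - 1 := by linarith
  have hq0 : 0 < q := by linarith
  have hqp : 0 ≤ q / p - 1 := by rw [sub_nonneg, le_div_iff₀ hp0]; linarith
  set I := ∫⁻ x, g x ^ p ∂μ with hI
  by_cases hIt : I = ∞
  · rw [hIt, ENNReal.top_rpow_of_pos (by positivity), ENNReal.mul_top]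
    · exact le_top
    · simp only [ne_eq, ENNReal.ofReal_eq_zero, not_le]; positivity
  -- Split `J^q = J^p J^(q-p)` and apply Hölder to the second factor only. The powers of `m` then
  -- combine to `m^(-p)`, which turns `J^p` into the `p`-th power of an ordinary average.
  have key : ∀ x, familySup P
        (fun i => μ (P i) ^ (-(1 / q + 1 - 1 / p)) * ∫⁻ y in P i, g y ∂μ) x ^ q ≤
      familySup P (setMean P μ g) x ^ p * I ^ (q / p - 1) := by
    intro x
    rw [← ENNReal.le_rpow_inv_iff hq0]
    refine familySup_le fun i hi => ?_
    rw [ENNReal.le_rpow_inv_iff hq0]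
    set J := ∫⁻ y in P i, g y ∂μ with hJ
    set m := μ (P i) with hm
    have hJI : J ≤ I ^ (1 / p) * m ^ (1 - 1 / p) :=
      setLIntegral_le_rpow_mul_measure_rpow μ hp hg _
    have hle : setMean P μ g i ≤ familySup P (setMean P μ g) x := le_familySup _ hi
    have h0 := hμ i
    have h1 := hμ' i
    calc (m ^ (-(1 / q + 1 - 1 / p)) * J) ^ q
        = m ^ (-(1 / q + 1 - 1 / p) * q) * (J ^ p * J ^ (q - p)) := by
          rw [ENNReal.mul_rpow_of_nonneg _ _ hq0.le, ← ENNReal.rpow_mul,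
            ← ENNReal.rpow_add_of_nonneg _ _ hp0.le (by linarith), add_sub_cancel]
      _ ≤ m ^ (-(1 / q + 1 - 1 / p) * q) *
            (J ^ p * (I ^ (1 / p) * m ^ (1 - 1 / p)) ^ (q - p)) := by
          gcongr
      _ = (m ^ (-(1 / q + 1 - 1 / p) * q) * m ^ ((1 - 1 / p) * (q - p))) * J ^ p *
            I ^ (q / p - 1) := by
          rw [ENNReal.mul_rpow_of_nonneg _ _ (by linarith : 0 ≤ q - p), ← ENNReal.rpow_mul,
            ← ENNReal.rpow_mul]
          have : 1 / p * (q - p) = q / p - 1 := by field_simp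
          rw [this]; ring
      _ = (m ^ (-1 : ℝ) * J) ^ p * I ^ (q / p - 1) := by
          rw [← ENNReal.rpow_add _ _ h0 h1, ENNReal.mul_rpow_of_nonneg _ _ hp0.le,
            ← ENNReal.rpow_mul]
          congr 4
          field_simp
          ring
      _ ≤ _ := by
          rw [ENNReal.rpow_neg_one]
          gcongr
          exact hle
  calc _ ≤ ∫⁻ x, familySup P (setMean P μ g) x ^ p * I ^ (q / p - 1) ∂μ := lintegral_mono key
    _ = (∫⁻ x, familySup P (setMean P μ g) x ^ p ∂μ) * I ^ (q / p - 1) :=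
        lintegral_mul_const _ ((measurable_familySup hP _).pow_const p)
    _ ≤ ENNReal.ofReal (2 ^ p * p / (p - 1)) * I * I ^ (q / p - 1) := by
        gcongr; exact hn.strong_type hP μ hp hg
    _ = _ := by
        rw [mul_assoc]
        congr 1
        nth_rewrite 1 [← ENNReal.rpow_one I]
        rw [← ENNReal.rpow_add_of_nonneg _ _ zero_le_one hqp, add_sub_cancel]

/-! ### The weighted inequality for nested families -/

theorem setLIntegral_withDensity_mul {X : Type*} [MeasurableSpace X] {ν : Measure X}
    {W g : X → ℝ≥0∞} (hW : AEMeasurable W ν) (hg : AEMeasurable g ν) {A : Set X}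
    (hA : MeasurableSet A) :
    ∫⁻ x in A, g x ∂(ν.withDensity W) = ∫⁻ x in A, W x * g x ∂ν := by
  rw [restrict_withDensity hA, lintegral_withDensity_eq_lintegral_mul₀ hW.restrict hg.restrict]
  rfl

theorem setLIntegral_ne_zero {X : Type*} [MeasurableSpace X] {ν : Measure X}
    {W : X → ℝ≥0∞} (hW : AEMeasurable W ν) (hW0 : ∀ᵐ x ∂ν, W x ≠ 0) {A : Set X}
    (hA : ν A ≠ 0) : ∫⁻ x in A, W x ∂ν ≠ 0 := by
  intro h
  rw [lintegral_eq_zero_iff' hW.restrict] at h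
  have : ∀ᵐ x ∂ν.restrict A, False := by
    filter_upwards [h, ae_restrict_of_ae hW0] with x h1 h2 using h2 h1
  simp only [Filter.eventually_false_iff_eq_bot, ae_eq_bot, Measure.restrict_eq_zero] at this
  exact hA this

/-- Sharp weighted bound for the fractional maximal operator of a nested family whose members
satisfy the Muckenhoupt condition with constant `K`. -/
theorem NestedFamily.weighted_strong_type {X ι : Type*} [MeasurableSpace X] [Countable ι]
    {P : ι → Set X} (hn : NestedFamily P)
    (hP : ∀ i, MeasurableSet (P i)) (ν : Measure X) [SFinite ν] {p q r : ℝ} (hp : 1 < p)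
    (hpq : p ≤ q) (hr : r = q * (1 - 1 / p) + 1) (hν : ∀ i, ν (P i) ≠ 0)
    (hν' : ∀ i, ν (P i) ≠ ∞) {W : X → ℝ≥0∞} (hW : AEMeasurable W ν)
    (hW0 : ∀ᵐ x ∂ν, W x ≠ 0) (hWt : ∀ᵐ x ∂ν, W x ≠ ∞)
    (hWP : ∀ i, ∫⁻ x in P i, W x ∂ν ≠ ∞) {K : ℝ≥0∞} (hKt : K ≠ ∞)
    (hK : ∀ i, ((ν (P i))⁻¹ * ∫⁻ x in P i, W x ∂ν) *
      ((ν (P i))⁻¹ * ∫⁻ x in P i, W x ^ (-1 / (r - 1)) ∂ν) ^ (r - 1) ≤ K)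
    {f : X → ℝ≥0∞} (hf : AEMeasurable f ν) :
    ∫⁻ x, familySup P (fun i => ν (P i) ^ (-(r / q)) * ∫⁻ y in P i, f y ∂ν) x ^ q * W x ∂ν ≤
      K ^ (r / (r - 1)) *
        (ENNReal.ofReal (2 ^ (r / (r - 1)) * (r / (r - 1)) / (r / (r - 1) - 1)) *
          (ENNReal.ofReal (2 ^ p * p / (p - 1)) *
            (∫⁻ x, f x ^ p * W x ^ (p / q) ∂ν) ^ (q / p))) := by
  have hp0 : 0 < p := by linarith
  have hp1 : 0 < p - 1 := by linarith
  have hq0 : 0 < q := by linarith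
  have hp1' : 0 < 1 - 1 / p := by rw [sub_pos, div_lt_one hp0]; exact hp
  have hr1 : 0 < r - 1 := by rw [hr, add_sub_cancel_right]; positivity
  have hr0 : 0 < r := by linarith
  set r' := r / (r - 1) with hr'
  have hr'1 : 1 < r' := by rw [hr', one_lt_div hr1]; linarith
  have hr'0 : 0 < r' := by linarith
  have hrq : 1 / q + 1 - 1 / p = r / q := by rw [hr]; field_simp; ring
  set S : X → ℝ≥0∞ := fun x => W x ^ (-1 / (r - 1)) with hS
  have hSm : AEMeasurable S ν := hW.pow_const _
  have hS0 : ∀ᵐ x ∂ν, S x ≠ 0 := by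
    filter_upwards [hW0, hWt] with x h0 h1
    exact (ENNReal.rpow_pos (pos_iff_ne_zero.2 h0) h1).ne'
  have hSt : ∀ᵐ x ∂ν, S x ≠ ∞ := by
    filter_upwards [hW0, hWt] with x h0 h1
    exact ENNReal.rpow_ne_top_of_ne_zero h0 h1
  set μS := ν.withDensity S with hμS
  set μW := ν.withDensity W with hμW
  have hSP : ∀ i, μS (P i) = ∫⁻ x in P i, S x ∂ν := fun i => withDensity_apply _ (hP i)
  have hWPe : ∀ i, μW (P i) = ∫⁻ x in P i, W x ∂ν := fun i => withDensity_apply _ (hP i)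
  have hSP0 : ∀ i, μS (P i) ≠ 0 := fun i => by
    rw [hSP]; exact setLIntegral_ne_zero hSm hS0 (hν i)
  have hWP0 : ∀ i, ∫⁻ x in P i, W x ∂ν ≠ 0 := fun i => setLIntegral_ne_zero hW hW0 (hν i)
  -- The `A_r` quantity would otherwise be infinite, as the average of `W` is positive.
  have hSPt : ∀ i, μS (P i) ≠ ∞ := fun i h => by
    have hi := hK i
    rw [hSP] at h
    rw [h, ENNReal.mul_top (ENNReal.inv_ne_zero.2 (hν' i)), ENNReal.top_rpow_of_pos hr1,
      ENNReal.mul_top (mul_ne_zero (ENNReal.inv_ne_zero.2 (hν' i)) (hWP0 i))] at hi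
    exact hKt (top_le_iff.1 hi)
  -- Dividing by the density makes the `S`-integral of `g` equal to the `ν`-integral of `f`; `h`
  -- below plays the same role for `W`.
  set g : X → ℝ≥0∞ := fun x => f x * (S x)⁻¹ with hg
  have hgm : AEMeasurable g ν := hf.mul hSm.inv
  have hgP : ∀ i, ∫⁻ x in P i, g x ∂μS = ∫⁻ x in P i, f x ∂ν := fun i => by
    rw [setLIntegral_withDensity_mul hSm hgm (hP i)]
    refine lintegral_congr_ae (ae_restrict_of_ae ?_)
    filter_upwards [hS0, hSt] with x h0 h1
    rw [hg, mul_left_comm, ENNReal.mul_inv_cancel h0 h1, mul_one]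
  set G := familySup P (fun i => μS (P i) ^ (-(1 / q + 1 - 1 / p)) * ∫⁻ y in P i, g y ∂μS)
    with hG
  have hGm : Measurable G := measurable_familySup hP _
  set h : X → ℝ≥0∞ := fun x => G x ^ (q / r') * (W x)⁻¹ with hh
  have hhm : AEMeasurable h ν := (hGm.pow_const _).aemeasurable.mul hW.inv
  have hhP : ∀ i, ∫⁻ x in P i, h x ∂μW = ∫⁻ x in P i, G x ^ (q / r') ∂ν := fun i => by
    rw [setLIntegral_withDensity_mul hW hhm (hP i)]
    refine lintegral_congr_ae (ae_restrict_of_ae ?_)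
    filter_upwards [hW0, hWt] with x h0 h1
    rw [hh, mul_left_comm, ENNReal.mul_inv_cancel h0 h1, mul_one]
  have key : ∀ x, familySup P (fun i => ν (P i) ^ (-(r / q)) * ∫⁻ y in P i, f y ∂ν) x ^ q ≤
      K ^ r' * familySup P (setMean P μW h) x ^ r' := by
    intro x
    rw [← ENNReal.le_rpow_inv_iff hq0]
    refine familySup_le fun i hi => ?_
    rw [ENNReal.le_rpow_inv_iff hq0]
    have hle : setMean P μW h i ≤ familySup P (setMean P μW h) x := le_familySup _ hi
    have hKi := hK i
    have n0 := hν i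
    have nt := hν' i
    have w0 := hWP0 i
    have wt := hWP i
    have s0 := hSP0 i
    have st := hSPt i
    rw [setMean, hhP, hWPe] at hle
    rw [← hSP] at hKi
    set n := ν (P i)
    set w := ∫⁻ x in P i, W x ∂ν
    set s := μS (P i)
    set J := ∫⁻ x in P i, f x ∂ν with hJ
    -- `G` is at least the term of index `i` at every point of `P i`.
    have hγ : (s ^ (-(r / q)) * J) ^ (q / r') * n ≤ ∫⁻ x in P i, G x ^ (q / r') ∂ν := by
      rw [← setLIntegral_const]
      refine setLIntegral_mono' (hP i) fun y hy => ?_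
      gcongr
      rw [hJ, ← hgP, ← hrq]
      exact le_familySup (P := P)
        (fun i => μS (P i) ^ (-(1 / q + 1 - 1 / p)) * ∫⁻ y in P i, g y ∂μS) hy
    calc (n ^ (-(r / q)) * J) ^ q = n ^ (-r) * (s ^ r * s ^ (-r)) * J ^ q := by
          rw [← ENNReal.rpow_add _ _ s0 st, add_neg_cancel, ENNReal.rpow_zero, mul_one,
            ENNReal.mul_rpow_of_nonneg _ _ hq0.le, ← ENNReal.rpow_mul]
          congr 3
          field_simp
      _ = ((n⁻¹ * s) ^ (r - 1) * (s ^ (-(r / q)) * J) ^ (q / r')) ^ r' := by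
          rw [ENNReal.mul_rpow_of_nonneg _ _ hr'0.le, ← ENNReal.rpow_mul, ← ENNReal.rpow_mul,
            div_mul_cancel₀ _ hr'0.ne', ENNReal.mul_rpow_of_nonneg _ _ hq0.le, ← ENNReal.rpow_mul]
          have e1 : (r - 1) * r' = r := by rw [hr']; field_simp
          have e2 : -(r / q) * q = -r := by field_simp
          rw [e1, e2, ENNReal.mul_rpow_of_nonneg _ _ hr0.le, ENNReal.inv_rpow,
            ← ENNReal.rpow_neg]
          ring
      -- Inserting `n⁻¹ n w⁻¹ w = 1` completes the `A_r` quantity and leaves a `W`-average.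
      _ = (((n⁻¹ * w) * (n⁻¹ * s) ^ (r - 1)) *
            (w⁻¹ * ((s ^ (-(r / q)) * J) ^ (q / r') * n))) ^ r' := by
          congr 1
          calc _ = (n⁻¹ * n) * (w⁻¹ * w) *
                ((n⁻¹ * s) ^ (r - 1) * (s ^ (-(r / q)) * J) ^ (q / r')) := by
                rw [ENNReal.inv_mul_cancel n0 nt, ENNReal.inv_mul_cancel w0 wt, one_mul, one_mul]
            _ = _ := by ring
      _ ≤ (K * (w⁻¹ * ∫⁻ x in P i, G x ^ (q / r') ∂ν)) ^ r' := by gcongr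
      _ ≤ (K * familySup P (setMean P μW h) x) ^ r' := by gcongr
      _ = _ := ENNReal.mul_rpow_of_nonneg _ _ hr'0.le
  have hMm : Measurable (familySup P (setMean P μW h)) := measurable_familySup hP _
  -- Here `W^(1-r') = S`, because `1 - r' = -1/(r-1)`.
  have e1 : ∫⁻ x, h x ^ r' ∂μW = ∫⁻ x, G x ^ q ∂μS := by
    rw [hμW, hμS, lintegral_withDensity_eq_lintegral_mul₀ hW (hhm.pow_const _),
      lintegral_withDensity_eq_lintegral_mul₀ hSm (hGm.pow_const _).aemeasurable]
    refine lintegral_congr_ae ?_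
    filter_upwards [hW0, hWt] with x h0 h1
    simp only [Pi.mul_apply, hh, hS]
    rw [ENNReal.mul_rpow_of_nonneg _ _ hr'0.le, ← ENNReal.rpow_mul, div_mul_cancel₀ _ hr'0.ne',
      ENNReal.inv_rpow, ← ENNReal.rpow_neg, mul_left_comm, mul_comm (G x ^ q)]
    congr 1
    nth_rewrite 1 [← ENNReal.rpow_one (W x)]
    rw [← ENNReal.rpow_add _ _ h0 h1]
    congr 1
    rw [hr']; field_simp; ring
  -- Here `S^(1-p) = W^(p/q)`, because `r - 1 = q (p-1)/p`.
  have e2 : ∫⁻ x, g x ^ p ∂μS = ∫⁻ x, f x ^ p * W x ^ (p / q) ∂ν := by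
    rw [hμS, lintegral_withDensity_eq_lintegral_mul₀ hSm (hgm.pow_const _)]
    refine lintegral_congr_ae ?_
    filter_upwards [hW0, hWt] with x h0 h1
    simp only [Pi.mul_apply, hg, hS]
    rw [ENNReal.mul_rpow_of_nonneg _ _ hp0.le, ← ENNReal.rpow_neg, ← ENNReal.rpow_mul,
      mul_left_comm, ← ENNReal.rpow_add _ _ h0 h1]
    congr 2
    rw [hr]; field_simp; ring
  calc _ ≤ ∫⁻ x, W x * (K ^ r' * familySup P (setMean P μW h) x ^ r') ∂ν := by
        refine lintegral_mono fun x => ?_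
        rw [mul_comm]
        exact mul_le_mul_right (key x) _
    _ = ∫⁻ x, K ^ r' * familySup P (setMean P μW h) x ^ r' ∂μW := by
        rw [hμW, lintegral_withDensity_eq_lintegral_mul₀ hW
          ((hMm.pow_const _).const_mul _).aemeasurable]
        rfl
    _ = K ^ r' * ∫⁻ x, familySup P (setMean P μW h) x ^ r' ∂μW :=
        lintegral_const_mul _ (hMm.pow_const _)
    _ ≤ _ := by
        gcongr
        refine (hn.strong_type hP μW hr'1
          (hhm.mono_ac (withDensity_absolutelyContinuous _ _))).trans ?_
        gcongr
        rw [e1, ← e2]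
        exact hn.fractional_strong_type hP μS hp hpq hSP0 hSPt
          (hgm.mono_ac (withDensity_absolutelyContinuous _ _))

/-! ### Shifted triadic grids -/

/-- The index of the cube of side `3 ^ k` containing `x`, in the triadic grid shifted by half a
side length in the coordinates where `n` is `1`. -/
noncomputable def triadicIndex {d : ℕ} (n : Fin d → Fin 2) (k : ℤ) (x : Fin d → ℝ) : Fin d → ℤ :=
  fun i => ⌊x i / 3 ^ k - (n i : ℕ) / 2⌋

/-- The cubes of the shifted triadic grid. -/
def triadicCube {d : ℕ} (n : Fin d → Fin 2) (a : ℤ × (Fin d → ℤ)) : Set (Fin d → ℝ) :=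
  {x | triadicIndex n a.1 x = a.2}

/-- Since `3/2 = 1 + 1/2`, tripling preserves half-integer shifts up to an integer. The coarser
index is thus a function of the finer one, which makes each shifted grid nested; this is why the
ratio is `3` rather than `2`. -/
theorem triadicIndex_succ {d : ℕ} (n : Fin d → Fin 2) (k : ℤ) (x : Fin d → ℝ) (i : Fin d) :
    triadicIndex n (k + 1) x i = (triadicIndex n k x i - (n i : ℕ)) / 3 := by
  have h := Int.floor_div_natCast (x i / 3 ^ k - (n i : ℕ) / 2 - (n i : ℕ)) 3
  rw [Int.floor_sub_natCast] at h
  rw [triadicIndex, triadicIndex, show ((3 : ℤ)) = ((3 : ℕ) : ℤ) from rfl, ← h]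
  congr 1
  rw [zpow_add₀ (by norm_num), zpow_one]
  push_cast
  field_simp
  ring

theorem triadicIndex_eq_of_le {d : ℕ} (n : Fin d → Fin 2) {k l : ℤ} (hkl : k ≤ l)
    {x y : Fin d → ℝ} (h : triadicIndex n k x = triadicIndex n k y) :
    triadicIndex n l x = triadicIndex n l y := by
  induction l, hkl using Int.leInduction with
  | base => exact h
  | succ l _ ih =>
    funext i
    rw [triadicIndex_succ, triadicIndex_succ, ih]

theorem nestedFamily_triadicCube {d : ℕ} (n : Fin d → Fin 2) :
    NestedFamily (triadicCube n) := by
  have key : ∀ a b : ℤ × (Fin d → ℤ), a.1 ≤ b.1 →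
      triadicCube n a ⊆ triadicCube n b ∨ Disjoint (triadicCube n a) (triadicCube n b) := by
    intro a b hab
    by_cases h : Disjoint (triadicCube n a) (triadicCube n b)
    · exact Or.inr h
    obtain ⟨z, hza, hzb⟩ := not_disjoint_iff.1 h
    refine Or.inl fun x hx => ?_
    exact (triadicIndex_eq_of_le n hab (Eq.trans hx (Eq.symm hza))).trans hzb
  intro a b
  rcases le_total a.1 b.1 with h | h
  · rcases key a b h with h | h
    · exact Or.inl h
    · exact Or.inr (Or.inr h)
  · rcases key b a h with h | h
    · exact Or.inr (Or.inl h)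
    · exact Or.inr (Or.inr h.symm)

theorem triadicCube_eq {d : ℕ} (n : Fin d → Fin 2) (a : ℤ × (Fin d → ℤ)) :
    triadicCube n a = univ.pi fun i => Ico ((3 : ℝ) ^ a.1 * (a.2 i + (n i : ℕ) / 2))
      ((3 : ℝ) ^ a.1 * (a.2 i + (n i : ℕ) / 2) + 3 ^ a.1) := by
  have h3 : (0 : ℝ) < 3 ^ a.1 := by positivity
  ext x
  simp only [triadicCube, mem_ofPred_eq, funext_iff, triadicIndex, mem_univ_pi, mem_Ico]
  refine forall_congr' fun i => ?_
  rw [Int.floor_eq_iff, le_sub_iff_add_le, sub_lt_iff_lt_add, le_div_iff₀ h3, div_lt_iff₀ h3]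
  refine and_congr (by rw [mul_comm]) ?_
  rw [show (3 : ℝ) ^ a.1 * (a.2 i + (n i : ℕ) / 2) + 3 ^ a.1 =
    (a.2 i + 1 + (n i : ℕ) / 2) * 3 ^ a.1 by ring]

theorem measurableSet_triadicCube {d : ℕ} (n : Fin d → Fin 2) (a : ℤ × (Fin d → ℤ)) :
    MeasurableSet (triadicCube n a) := by
  rw [triadicCube_eq]
  exact MeasurableSet.univ_pi fun i => measurableSet_Ico

theorem volume_triadicCube {d : ℕ} (n : Fin d → Fin 2) (a : ℤ × (Fin d → ℤ)) :
    volume (triadicCube n a) = ENNReal.ofReal (3 ^ a.1) ^ d := by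
  rw [triadicCube_eq, volume_pi, Measure.pi_pi]
  simp

theorem exists_isCube_ae_eq_triadicCube {d : ℕ} (n : Fin d → Fin 2) (a : ℤ × (Fin d → ℤ)) :
    ∃ Q, IsCube Q ∧ triadicCube n a =ᵐ[volume] Q := by
  refine ⟨_, ⟨fun i => (3 : ℝ) ^ a.1 * (a.2 i + (n i : ℕ) / 2), 3 ^ a.1, by positivity, rfl⟩, ?_⟩
  rw [triadicCube_eq]
  exact Measure.univ_pi_Ico_ae_eq_Icc

/-- Integers and half-integers are at distance at least `1 / 2`. -/
theorem exists_floor_sub_half_eq (x l : ℝ) (hl : l < 1 / 2) :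
    ∃ n : Fin 2, ∀ y ∈ Icc x (x + l), ⌊y - (n : ℕ) / 2⌋ = ⌊x - (n : ℕ) / 2⌋ := by
  by_cases h : x + l < ⌊x⌋ + 1
  · refine ⟨0, fun y hy => ?_⟩
    simp only [Fin.val_zero, Nat.cast_zero, zero_div, sub_zero]
    rw [Int.floor_eq_iff]
    exact ⟨(Int.floor_le x).trans hy.1, hy.2.trans_lt h⟩
  -- The interval reaches the integer `⌊x⌋ + 1`, so `x > ⌊x⌋ + 1/2` and no half-integer is met.
  · refine ⟨1, fun y hy => ?_⟩
    simp only [Fin.val_one, Nat.cast_one]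
    have h1 := Int.lt_floor_add_one x
    have h2 : ⌊x - 1 / 2⌋ = ⌊x⌋ := by
      rw [Int.floor_eq_iff]
      constructor <;> linarith
    rw [h2, Int.floor_eq_iff]
    constructor <;> linarith [hy.1, hy.2]

/-- Every cube is contained in a cube of comparable size of one of the shifted triadic grids. -/
theorem IsCube.exists_subset_triadicCube {d : ℕ} {Q : Set (Fin d → ℝ)} (hQ : IsCube Q) :
    ∃ (n : Fin d → Fin 2) (a : ℤ × (Fin d → ℤ)), Q ⊆ triadicCube n a ∧
      volume (triadicCube n a) ≤ 6 ^ d * volume Q := by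
  obtain ⟨c, l, hl, rfl⟩ := hQ
  -- With `3^k ≤ 2l < 3^(k+1)`, the side `3^(k+1)` exceeds `2l`, as the choice of shift requires,
  -- and is at most `6l`.
  obtain ⟨k, hk, hk'⟩ := exists_mem_Ico_zpow (show 0 < 2 * l by linarith)
    (show (1 : ℝ) < 3 by norm_num)
  have h3 : (0 : ℝ) < 3 ^ (k + 1) := by positivity
  have hl2 : l / 3 ^ (k + 1) < 1 / 2 := by
    rw [div_lt_iff₀ h3]; linarith
  choose n hn using fun i => exists_floor_sub_half_eq (c i / 3 ^ (k + 1)) _ hl2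
  refine ⟨n, (k + 1, triadicIndex n (k + 1) c), fun x hx => ?_, ?_⟩
  · funext i
    refine hn i _ ⟨?_, ?_⟩
    · exact div_le_div_of_nonneg_right (hx.1 i) h3.le
    · rw [← add_div]
      exact div_le_div_of_nonneg_right (hx.2 i) h3.le
  · rw [volume_triadicCube, Real.volume_Icc_pi]
    simp only [add_sub_cancel_left, Finset.prod_const, Finset.card_univ, Fintype.card_fin]
    rw [← mul_pow]
    gcongr
    rw [show (6 : ℝ≥0∞) = ENNReal.ofReal 6 by simp, ← ENNReal.ofReal_mul (by norm_num)]
    apply ENNReal.ofReal_le_ofReal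
    rw [zpow_add₀ (by norm_num), zpow_one]
    linarith

/-! ### Passage from all cubes to the grids, and conclusion -/

/-- As `α/d - 1 ≤ 0`, enlarging a cube to a triadic one costs at most the factor `(6^d)^(1-α/d)`.
Summing after taking `q`-th powers lets the grids be integrated separately. -/
theorem fracMaximal_rpow_le_sum {d : ℕ} {α q : ℝ} (hα : α / d ≤ 1) (hq : 0 < q)
    (φ : (Fin d → ℝ) → ℝ) (x : Fin d → ℝ) :
    fracMaximal α φ x ^ q ≤ ((6 ^ d : ℝ≥0∞) ^ (1 - α / d)) ^ q * ∑ n : Fin d → Fin 2,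
      familySup (triadicCube n) (fun a => volume (triadicCube n a) ^ (-(1 - α / d)) *
        ∫⁻ u in triadicCube n a, ‖φ u‖ₑ) x ^ q := by
  have hθ : 0 ≤ 1 - α / d := by linarith
  rw [← ENNReal.le_rpow_inv_iff hq]
  refine iSup_le fun Q => iSup₂_le fun hQ hx => ?_
  rw [ENNReal.le_rpow_inv_iff hq]
  obtain ⟨n, a, hQT, hvol⟩ := hQ.exists_subset_triadicCube
  have h6 : (6 ^ d : ℝ≥0∞) ≠ 0 := by positivity
  have h6' : (6 ^ d : ℝ≥0∞) ≠ ∞ := by finiteness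
  have hv : volume Q ^ (α / d - 1) ≤
      (6 ^ d : ℝ≥0∞) ^ (1 - α / d) * volume (triadicCube n a) ^ (-(1 - α / d)) := by
    have h1 : volume (triadicCube n a) * (6 ^ d : ℝ≥0∞)⁻¹ ≤ volume Q := by
      rw [← div_eq_mul_inv]
      exact ENNReal.div_le_of_le_mul' hvol
    calc volume Q ^ (α / d - 1) = (volume Q ^ (1 - α / d))⁻¹ := by
          rw [← ENNReal.rpow_neg, neg_sub]
      _ ≤ ((volume (triadicCube n a) * (6 ^ d : ℝ≥0∞)⁻¹) ^ (1 - α / d))⁻¹ := by gcongr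
      _ = _ := by
          rw [ENNReal.mul_rpow_of_nonneg _ _ hθ, ENNReal.mul_inv, ENNReal.inv_rpow, inv_inv,
            mul_comm, ENNReal.rpow_neg]
          · right
            exact ENNReal.rpow_ne_top_of_nonneg hθ (ENNReal.inv_ne_top.2 h6)
          · right
            exact (ENNReal.rpow_pos (ENNReal.inv_pos.2 h6') (ENNReal.inv_ne_top.2 h6)).ne'
  set F := fun (n : Fin d → Fin 2) (a : ℤ × (Fin d → ℤ)) =>
    volume (triadicCube n a) ^ (-(1 - α / d)) * ∫⁻ u in triadicCube n a, ‖φ u‖ₑ with hF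
  calc _ ≤ ((6 ^ d : ℝ≥0∞) ^ (1 - α / d) * F n a) ^ q := by
        rw [hF, ← mul_assoc]
        gcongr
    _ ≤ ((6 ^ d : ℝ≥0∞) ^ (1 - α / d) * familySup (triadicCube n) (F n) x) ^ q := by
        gcongr
        exact le_familySup (F n) (hQT hx)
    _ = ((6 ^ d : ℝ≥0∞) ^ (1 - α / d)) ^ q * familySup (triadicCube n) (F n) x ^ q :=
        ENNReal.mul_rpow_of_nonneg _ _ hq.le
    _ ≤ _ := by
        gcongr
        exact Finset.single_le_sum (f := fun n => familySup (triadicCube n) (F n) x ^ q)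
          (fun _ _ => zero_le) (Finset.mem_univ n)

/-- The half-open grid cubes differ from closed cubes by null sets. -/
theorem triadicCube_muckenhoupt_le_apChar {d : ℕ} (r : ℝ) (w : (Fin d → ℝ) → ℝ)
    (n : Fin d → Fin 2) (a : ℤ × (Fin d → ℤ)) :
    ((volume (triadicCube n a))⁻¹ * ∫⁻ x in triadicCube n a, ENNReal.ofReal (w x)) *
      ((volume (triadicCube n a))⁻¹ *
        ∫⁻ x in triadicCube n a, ENNReal.ofReal (w x) ^ (-1 / (r - 1))) ^ (r - 1) ≤
      ApChar r w := by
  obtain ⟨Q, hQ, h⟩ := exists_isCube_ae_eq_triadicCube n a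
  rw [setLIntegral_congr h, setLIntegral_congr h, measure_congr h]
  exact le_iSup₂ (f := fun Q (_ : IsCube Q) =>
    ((volume Q)⁻¹ * ∫⁻ x in Q, ENNReal.ofReal (w x)) *
      ((volume Q)⁻¹ * ∫⁻ x in Q, ENNReal.ofReal (w x) ^ (-1 / (r - 1))) ^ (r - 1)) Q hQ

theorem setLIntegral_triadicCube_ne_top {d : ℕ} {w : (Fin d → ℝ) → ℝ}
    (hw : LocallyIntegrable w volume) (n : Fin d → Fin 2) (a : ℤ × (Fin d → ℤ)) :
    ∫⁻ x in triadicCube n a, ENNReal.ofReal (w x) ≠ ∞ := by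
  obtain ⟨Q, ⟨b, l, -, rfl⟩, h⟩ := exists_isCube_ae_eq_triadicCube n a
  rw [setLIntegral_congr h]
  have hi := (hw.integrableOn_isCompact (k := Icc b fun i => b i + l) isCompact_Icc).2
  refine (lt_of_le_of_lt (lintegral_mono fun x => ?_) hi).ne
  exact Real.ofReal_le_enorm (w x)

theorem exists_weightedNorm_fracMaximal_le {d : ℕ} (hd : 1 ≤ d) {p α q : ℝ} (hp : 1 < p)
    (hα : 0 ≤ α) (hαd : α < d) (hq : 0 < q) (hpq : 1 / q = 1 / p - α / d) :
    ∃ C : ℝ≥0, 0 < C ∧ ∀ w φ : (Fin d → ℝ) → ℝ,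
      IsApWeight (q / Real.conjExponent p + 1) w → LocallyIntegrable φ volume →
        weightedNorm q w (fracMaximal α φ) ≤
          C * ApChar (q / Real.conjExponent p + 1) w ^
                ((1 - α / d) * Real.conjExponent p / q) *
            weightedNorm p (fun x => w x ^ (p / q)) (fun x => ‖φ x‖ₑ) := by
  have hd0 : (0 : ℝ) < d := by exact_mod_cast hd
  have hp0 : 0 < p := by linarith
  have hp1 : 0 < p - 1 := by linarith
  have hα1 : α / d ≤ 1 := by rw [div_le_one hd0]; exact hαd.le
  have hle : p ≤ q := by
    have : 0 ≤ α / d := by positivity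
    exact (one_div_le_one_div hq hp0).1 (by linarith)
  set r := q / Real.conjExponent p + 1 with hr
  have hre : r = q * (1 - 1 / p) + 1 := by
    rw [hr, Real.conjExponent]; field_simp
  have hp1' : 0 < 1 - 1 / p := by rw [sub_pos, div_lt_one hp0]; exact hp
  have hr1 : 0 < r - 1 := by rw [hre, add_sub_cancel_right]; positivity
  have hr0 : 0 < r := by linarith
  -- The relation between `p`, `q` and `α` enters here: the order of the operator matches the
  -- exponent `r / q` of the nested bound.
  have hθ : 1 - α / d = r / q := by
    have : α / d = 1 / p - 1 / q := by linarith
    rw [this, hre]; field_simp; ring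
  have hexp : (1 - α / d) * Real.conjExponent p / q = r / (r - 1) * (1 / q) := by
    rw [hθ, hre, Real.conjExponent]; field_simp
    ring
  set r' := r / (r - 1) with hr'
  have hr'1 : 1 < r' := by rw [hr', one_lt_div hr1]; linarith
  have hr'2 : 0 < r' - 1 := by linarith
  have hr'0 : 0 < r' := by linarith
  -- The factors are the loss from enlarging cubes, the number `2^d` of grids, and the two strong
  -- type constants.
  set D : ℝ≥0∞ := ((6 ^ d : ℝ≥0∞) ^ (1 - α / d)) ^ q * (Fintype.card (Fin d → Fin 2) *
    (ENNReal.ofReal (2 ^ r' * r' / (r' - 1)) * ENNReal.ofReal (2 ^ p * p / (p - 1)))) with hD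
  have hDt : D ≠ ∞ := by
    have h6 : ((6 ^ d : ℝ≥0∞) ^ (1 - α / d)) ^ q ≠ ∞ :=
      ENNReal.rpow_ne_top_of_nonneg hq.le
        (ENNReal.rpow_ne_top_of_nonneg (by linarith) (by finiteness))
    exact ENNReal.mul_ne_top h6 (by finiteness)
  have hD0 : D ≠ 0 := by
    have h6 : ((6 ^ d : ℝ≥0∞) ^ (1 - α / d)) ^ q ≠ 0 :=
      (ENNReal.rpow_pos (ENNReal.rpow_pos (by positivity) (by finiteness))
        (ENNReal.rpow_ne_top_of_nonneg (by linarith) (by finiteness))).ne'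
    have h1 : ENNReal.ofReal (2 ^ r' * r' / (r' - 1)) ≠ 0 :=
      (ENNReal.ofReal_pos.2 (by positivity)).ne'
    have h2 : ENNReal.ofReal (2 ^ p * p / (p - 1)) ≠ 0 :=
      (ENNReal.ofReal_pos.2 (by positivity)).ne'
    exact mul_ne_zero h6 (mul_ne_zero (by simp) (mul_ne_zero h1 h2))
  have hCt : D ^ (1 / q) ≠ ∞ := ENNReal.rpow_ne_top_of_nonneg (by positivity) hDt
  have hC0 : D ^ (1 / q) ≠ 0 := (ENNReal.rpow_pos (pos_iff_ne_zero.2 hD0) hDt).ne'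
  refine ⟨(D ^ (1 / q)).toNNReal, ENNReal.toNNReal_pos hC0 hCt, fun w φ hw hφ => ?_⟩
  obtain ⟨⟨hwi, hw0⟩, hK⟩ := hw
  rw [ENNReal.coe_toNNReal hCt, hexp]
  set K := ApChar r w
  set W : (Fin d → ℝ) → ℝ≥0∞ := fun x => ENNReal.ofReal (w x) with hWdef
  have hW : AEMeasurable W := hwi.aestronglyMeasurable.aemeasurable.ennreal_ofReal
  have hφm : AEMeasurable (fun x => ‖φ x‖ₑ) := hφ.aestronglyMeasurable.enorm
  set N := ∫⁻ x, ‖φ x‖ₑ ^ p * W x ^ (p / q) with hN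
  have hNe : weightedNorm p (fun x => w x ^ (p / q)) (fun x => ‖φ x‖ₑ) = N ^ (1 / p) := by
    rw [weightedNorm, hN]
    congr 1
    refine lintegral_congr_ae ?_
    filter_upwards [hw0] with x hx
    rw [hWdef, ENNReal.ofReal_rpow_of_pos hx]
  have hgrid : ∀ n : Fin d → Fin 2,
      ∫⁻ x, familySup (triadicCube n) (fun a => volume (triadicCube n a) ^ (-(1 - α / d)) *
        ∫⁻ u in triadicCube n a, ‖φ u‖ₑ) x ^ q * W x ≤
      K ^ r' * (ENNReal.ofReal (2 ^ r' * r' / (r' - 1)) *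
        (ENNReal.ofReal (2 ^ p * p / (p - 1)) * N ^ (q / p))) := by
    intro n
    rw [hθ]
    refine (nestedFamily_triadicCube n).weighted_strong_type (measurableSet_triadicCube n) volume
      hp hle hre (fun a => ?_) (fun a => ?_) hW ?_ ?_
      (setLIntegral_triadicCube_ne_top hwi n) hK.ne
      (triadicCube_muckenhoupt_le_apChar r w n) hφm
    · rw [volume_triadicCube]
      exact pow_ne_zero _ (ENNReal.ofReal_pos.2 (by positivity)).ne'
    · rw [volume_triadicCube]; finiteness
    · filter_upwards [hw0] with x hx using (ENNReal.ofReal_pos.2 hx).ne'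
    · exact Filter.Eventually.of_forall fun x => ENNReal.ofReal_ne_top
  have hmain : ∫⁻ x, fracMaximal α φ x ^ q * W x ≤ D * K ^ r' * N ^ (q / p) := by
    set F := fun (n : Fin d → Fin 2) => familySup (triadicCube n)
      (fun a => volume (triadicCube n a) ^ (-(1 - α / d)) *
        ∫⁻ u in triadicCube n a, ‖φ u‖ₑ) with hF
    have hFm : ∀ n, AEMeasurable (fun x => F n x ^ q * W x) := fun n =>
      ((measurable_familySup (measurableSet_triadicCube n) _).pow_const q).aemeasurable.mul hW
    set B := ((6 ^ d : ℝ≥0∞) ^ (1 - α / d)) ^ q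
    calc _ ≤ ∫⁻ x, B * ∑ n, F n x ^ q * W x := by
          refine lintegral_mono fun x => ?_
          rw [← Finset.sum_mul, ← mul_assoc]
          exact mul_le_mul_left (fracMaximal_rpow_le_sum hα1 hq φ x) _
      _ = B * ∑ n, ∫⁻ x, F n x ^ q * W x := by
          rw [lintegral_const_mul'' _ (Finset.aemeasurable_fun_sum _ fun n _ => hFm n),
            lintegral_finsetSum' _ fun n _ => hFm n]
      _ ≤ B * ∑ _n : Fin d → Fin 2, K ^ r' * (ENNReal.ofReal (2 ^ r' * r' / (r' - 1)) *
            (ENNReal.ofReal (2 ^ p * p / (p - 1)) * N ^ (q / p))) := by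
          gcongr with n
          exact hgrid n
      _ = _ := by
          rw [Finset.sum_const, Finset.card_univ, nsmul_eq_mul, hD]; ring
  rw [hNe, weightedNorm]
  calc _ ≤ (D * K ^ r' * N ^ (q / p)) ^ (1 / q) := by gcongr
    _ = _ := by
        have hq1 : 0 ≤ 1 / q := by positivity
        rw [ENNReal.mul_rpow_of_nonneg _ _ hq1, ENNReal.mul_rpow_of_nonneg _ _ hq1,
          ← ENNReal.rpow_mul, ← ENNReal.rpow_mul]
        congr 2
        field_simp

theorem mainTheorem3 (d : ℕ) (hd : 1 ≤ d) (p : ℝ) (hp : 1 < p) :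
    (∀ α q : ℝ, 0 ≤ α → α < d → 0 < q → 1 / q = 1 / p - α / d →
      ∃ C : ℝ≥0, 0 < C ∧
        ∀ w φ : (Fin d → ℝ) → ℝ,
          IsApWeight (q / Real.conjExponent p + 1) w → LocallyIntegrable φ volume →
            weightedNorm q w (fracMaximal α φ) ≤
              C * ApChar (q / Real.conjExponent p + 1) w ^
                    ((1 - α / d) * Real.conjExponent p / q) *
                weightedNorm p (fun x => w x ^ (p / q)) (fun x => ‖φ x‖ₑ)) ∧
    (∃ C : ℝ≥0, 0 < C ∧
      ∀ w φ : (Fin d → ℝ) → ℝ,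
        IsApWeight p w → LocallyIntegrable φ volume →
          weightedNorm p w (fracMaximal 0 φ) ≤
            C * ApChar p w ^ (1 / (p - 1)) * weightedNorm p w (fun x => ‖φ x‖ₑ)) := by
  refine ⟨fun α q hα hαd hq hpq => exists_weightedNorm_fracMaximal_le hd hp hα hαd hq hpq, ?_⟩
  have hp0 : 0 < p := by linarith
  have hp1 : 0 < p - 1 := by linarith
  have hd0 : (0 : ℝ) < d := by exact_mod_cast hd
  have h := exists_weightedNorm_fracMaximal_le hd hp le_rfl hd0 hp0 (by simp)
  have h1 : p / Real.conjExponent p + 1 = p := by rw [Real.conjExponent]; field_simp; ring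
  have h2 : (1 - 0 / (d : ℝ)) * Real.conjExponent p / p = 1 / (p - 1) := by
    rw [Real.conjExponent]; field_simp; simp
  simpa only [h1, h2, div_self hp0.ne', Real.rpow_one] using h
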